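/- Let $k$ be a field of characteristic zero, let $R=k[h]$, let $a\in R$ and let $\sigma\in\operatorname{Aut}_k(R)$ be a $k$-algebra automorphism. Let $\Lambda=\Lambda(R,\sigma,a)$ be the Bavula algebra (rank-one generalized Weyl algebra), that is, the $k$-algebra generated by the algebra $R$ and two variables $x,y$ subject to the relations $$yx=a,\qquad xy=\sigma(a),\qquad xr=\sigma(r)x,\qquad ry=y\sigma(r)\qquad(r\in R).$$ Let $\operatorname{gldim}\Lambda$ be the global dimension of $\Lambda$, the supremum of the projective dimensions of its left modules, and let $a'$ be the derivative of $a$. Then $$\operatorname{gldim}\Lambda<\infty\iff \gcd(a,a')=1.$$ -/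

import Mathlib

open Polynomial

universe u v

/-- The generators of a Bavula (generalized Weyl) algebra over `R`: one for each element of `R`,
and two further letters `x` and `y`. -/
inductive BavulaGen (R : Type v) : Type v
  | coeff (r : R) : BavulaGen R
  | x : BavulaGen R
  | y : BavulaGen R

/-- The defining relations of the Bavula algebra `Λ(R, σ, a)` on the free `k`-algebra on
`BavulaGen R`. The first three say that `R` is mapped to the quotient by a homomorphism of
`k`-algebras; the other ones are `yx = a`, `xy = σ(a)`, `xr = σ(r)x` and `ry = yσ(r)`. -/
inductive BavulaRel (k : Type u) {R : Type v} [CommRing k] [Ring R] [Algebra k R]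
    (σ : R ≃ₐ[k] R) (a : R) :
    FreeAlgebra k (BavulaGen R) → FreeAlgebra k (BavulaGen R) → Prop
  | coeff_add (r s : R) : BavulaRel k σ a
      (FreeAlgebra.ι k (BavulaGen.coeff (r + s)))
      (FreeAlgebra.ι k (BavulaGen.coeff r) + FreeAlgebra.ι k (BavulaGen.coeff s))
  | coeff_mul (r s : R) : BavulaRel k σ a
      (FreeAlgebra.ι k (BavulaGen.coeff (r * s)))
      (FreeAlgebra.ι k (BavulaGen.coeff r) * FreeAlgebra.ι k (BavulaGen.coeff s))
  | coeff_algebraMap (c : k) : BavulaRel k σ a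
      (FreeAlgebra.ι k (BavulaGen.coeff (algebraMap k R c)))
      (algebraMap k (FreeAlgebra k (BavulaGen R)) c)
  | y_mul_x : BavulaRel k σ a
      (FreeAlgebra.ι k BavulaGen.y * FreeAlgebra.ι k BavulaGen.x)
      (FreeAlgebra.ι k (BavulaGen.coeff a))
  | x_mul_y : BavulaRel k σ a
      (FreeAlgebra.ι k BavulaGen.x * FreeAlgebra.ι k BavulaGen.y)
      (FreeAlgebra.ι k (BavulaGen.coeff (σ a)))
  | x_mul_coeff (r : R) : BavulaRel k σ a
      (FreeAlgebra.ι k BavulaGen.x * FreeAlgebra.ι k (BavulaGen.coeff r))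
      (FreeAlgebra.ι k (BavulaGen.coeff (σ r)) * FreeAlgebra.ι k BavulaGen.x)
  | coeff_mul_y (r : R) : BavulaRel k σ a
      (FreeAlgebra.ι k (BavulaGen.coeff r) * FreeAlgebra.ι k BavulaGen.y)
      (FreeAlgebra.ι k BavulaGen.y * FreeAlgebra.ι k (BavulaGen.coeff (σ r)))

/-- The Bavula algebra (generalized Weyl algebra) `Λ(R, σ, a)`: the `k`-algebra generated by `R`
and two letters `x`, `y` subject to `yx = a`, `xy = σ(a)`, `xr = σ(r)x`, `ry = yσ(r)`. -/
abbrev BavulaAlgebra (k : Type u) {R : Type v} [CommRing k] [Ring R] [Algebra k R]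
    (σ : R ≃ₐ[k] R) (a : R) : Type (max u v) :=
  RingQuot (BavulaRel k σ a)

/-- The (left) global dimension of a ring: the supremum of the projective dimensions of its
left modules (it is `⊥` exactly for the zero ring). -/
noncomputable def leftGlobalDimension (A : Type u) [Ring A] : WithBot ℕ∞ :=
  ⨆ M : ModuleCat.{u} A, CategoryTheory.projectiveDimension M

/-! Write Λ for the algebra. It is free as a left R-module on the powers of x and y, graded by ℤ,
and both directions rest on this normal form.

If a and a' are not coprime, then a = p²b with p a nonzero nonunit (characteristic zero enters
here). The two factors p and pb of a define endomorphisms φ, ψ of Λ² with ker φ = im ψ and ker ψ =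
im φ, a matrix factorization of a. Finite global dimension makes these images projective, so φsφ = φ
for some s. The degree-zero part of one entry of this identity gives σ(p)² ∣ σ(p), which is absurd
(`mul_self_dvd_of_comp_comp_eq_self`).

If a and a' are coprime, the global dimension is at most 2. A first syzygy is projective over k[X],
since Λ is free over the hereditary ring k[X]; so it is enough that a Λ-module M projective over
k[X] has projective dimension at most 1 (`projective_ker`). Take F → M with kernel K and N → K, both
onto, with F and N free. If the extension F of M by K lifts to an extension of M by N, then K is a
summand of N. The obstruction consists of the defects (g, h) in the relations yx = a and xy = σ(a).
It vanishes because multiplication by a and by a' are both null-homotopic, hence so is 1: for a the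
homotopy is x itself, for a' it comes from commuting a connection on M with x and y
(`exists_homotopy_derivative`). -/

namespace BavulaAlgebra

/-! ### Generators, relations and the universal property -/

section Basic

variable {k : Type u} {R : Type v} [CommRing k] [CommRing R] [Algebra k R]
variable (σ : R ≃ₐ[k] R) (a : R)

/-- The class in the Bavula algebra of a generator. -/
noncomputable def gen (g : BavulaGen R) : BavulaAlgebra k σ a :=
  RingQuot.mkAlgHom k (BavulaRel k σ a) (FreeAlgebra.ι k g)

/-- The structure map `R → Λ(R, σ, a)`. -/
noncomputable def coeff : R →ₐ[k] BavulaAlgebra k σ a :=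
  AlgHom.ofLinearMap
    { toFun := fun r => gen σ a (.coeff r)
      map_add' := fun r s => by
        simpa [gen] using RingQuot.mkAlgHom_rel k (BavulaRel.coeff_add (σ := σ) (a := a) r s)
      map_smul' := fun c r => by
        have h₁ := RingQuot.mkAlgHom_rel k
          (BavulaRel.coeff_mul (σ := σ) (a := a) (algebraMap k R c) r)
        have h₂ := RingQuot.mkAlgHom_rel k (BavulaRel.coeff_algebraMap (σ := σ) (a := a) c)
        simp only [map_mul] at h₁
        rw [h₂, AlgHom.commutes] at h₁
        simpa [gen, Algebra.smul_def] using h₁ }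
    (by
      have h₂ := RingQuot.mkAlgHom_rel k (BavulaRel.coeff_algebraMap (σ := σ) (a := a) 1)
      simpa [gen] using h₂)
    (fun r s => by
      simpa [gen] using RingQuot.mkAlgHom_rel k (BavulaRel.coeff_mul (σ := σ) (a := a) r s))

/-- The generator `x` of the Bavula algebra. -/
noncomputable def x : BavulaAlgebra k σ a := gen σ a .x

/-- The generator `y` of the Bavula algebra. -/
noncomputable def y : BavulaAlgebra k σ a := gen σ a .y

lemma y_mul_x : y σ a * x σ a = coeff σ a a := by
  simpa using! RingQuot.mkAlgHom_rel k (BavulaRel.y_mul_x (σ := σ) (a := a))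

lemma x_mul_y : x σ a * y σ a = coeff σ a (σ a) := by
  simpa using! RingQuot.mkAlgHom_rel k (BavulaRel.x_mul_y (σ := σ) (a := a))

lemma x_mul_coeff (r : R) : x σ a * coeff σ a r = coeff σ a (σ r) * x σ a := by
  simpa using! RingQuot.mkAlgHom_rel k (BavulaRel.x_mul_coeff (σ := σ) (a := a) r)

lemma coeff_mul_y (r : R) : coeff σ a r * y σ a = y σ a * coeff σ a (σ r) := by
  simpa using! RingQuot.mkAlgHom_rel k (BavulaRel.coeff_mul_y (σ := σ) (a := a) r)

variable {σ a} in
@[elab_as_elim]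
lemma induction {P : BavulaAlgebra k σ a → Prop} (hcoeff : ∀ r, P (coeff σ a r))
    (hx : P (x σ a)) (hy : P (y σ a)) (hadd : ∀ z w, P z → P w → P (z + w))
    (hmul : ∀ z w, P z → P w → P (z * w)) (z : BavulaAlgebra k σ a) : P z := by
  obtain ⟨z, rfl⟩ := RingQuot.mkAlgHom_surjective k (BavulaRel k σ a) z
  induction z using FreeAlgebra.induction with
  | grade0 c =>
    rw [AlgHom.commutes, ← (coeff σ a).commutes]
    exact hcoeff _
  | grade1 g =>
    cases g with
    | coeff r => exact hcoeff r
    | x => exact hx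
    | y => exact hy
  | mul z w hz hw => rw [map_mul]; exact hmul _ _ hz hw
  | add z w hz hw => rw [map_add]; exact hadd _ _ hz hw

variable {B : Type*} [Ring B] [Algebra k B] (ρ : R →ₐ[k] B) (X Y : B)

/-- The universal property of the Bavula algebra. -/
noncomputable def lift (h₁ : Y * X = ρ a) (h₂ : X * Y = ρ (σ a)) (h₃ : ∀ r, X * ρ r = ρ (σ r) * X)
    (h₄ : ∀ r, ρ r * Y = Y * ρ (σ r)) : BavulaAlgebra k σ a →ₐ[k] B :=
  RingQuot.liftAlgHom k ⟨FreeAlgebra.lift k fun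
    | .coeff r => ρ r
    | .x => X
    | .y => Y, by
      rintro _ _ (⟨r, s⟩ | ⟨r, s⟩ | ⟨c⟩ | _ | _ | ⟨r⟩ | ⟨r⟩) <;> simp [h₁, h₂, h₃, h₄]⟩

variable (h₁ : Y * X = ρ a) (h₂ : X * Y = ρ (σ a)) (h₃ : ∀ r, X * ρ r = ρ (σ r) * X)
    (h₄ : ∀ r, ρ r * Y = Y * ρ (σ r))

@[simp]
lemma lift_coeff (r : R) : lift σ a ρ X Y h₁ h₂ h₃ h₄ (coeff σ a r) = ρ r := by
  change lift σ a ρ X Y h₁ h₂ h₃ h₄ (gen σ a (.coeff r)) = ρ r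
  simp [gen, lift]

@[simp]
lemma lift_x : lift σ a ρ X Y h₁ h₂ h₃ h₄ (x σ a) = X := by
  simp [x, gen, lift]

@[simp]
lemma lift_y : lift σ a ρ X Y h₁ h₂ h₃ h₄ (y σ a) = Y := by
  simp [y, gen, lift]

lemma adjoin_generators :
    Algebra.adjoin k (Set.range (coeff σ a) ∪ {x σ a, y σ a}) = ⊤ := by
  refine eq_top_iff.2 fun z _ => ?_
  induction z using induction with
  | hcoeff r => exact Algebra.subset_adjoin (Or.inl ⟨r, rfl⟩)
  | hx => exact Algebra.subset_adjoin (Or.inr (Or.inl rfl))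
  | hy => exact Algebra.subset_adjoin (Or.inr (Or.inr rfl))
  | hadd z w hz hw => exact add_mem (hz trivial) (hw trivial)
  | hmul z w hz hw => exact mul_mem (hz trivial) (hw trivial)

end Basic

/-! ### The monomial basis and the grading -/

section NormalForm

variable {k : Type u} {R : Type v} [CommRing k] [CommRing R] [Algebra k R]
variable (σ : R ≃ₐ[k] R) (a : R)

/-- The monomial of degree `n`: a power of `x` for `0 ≤ n` and a power of `y` for `n ≤ 0`. -/
noncomputable def monomial (n : ℤ) : BavulaAlgebra k σ a :=
  if 0 ≤ n then x σ a ^ n.toNat else y σ a ^ (-n).toNat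

lemma monomial_natCast (n : ℕ) : monomial σ a (n : ℤ) = x σ a ^ n := by
  simp [monomial]

lemma monomial_neg_natCast (n : ℕ) : monomial σ a (-(n : ℤ)) = y σ a ^ n := by
  rcases n with _ | n
  · simp [monomial]
  · rw [monomial, if_neg (by lia)]
    congr 1

@[simp]
lemma monomial_zero : monomial σ a 0 = 1 := by simp [monomial]

lemma int_cases {P : ℤ → Prop} (h : ∀ n : ℕ, P n) (h' : ∀ n : ℕ, P (-((n + 1 : ℕ) : ℤ)))
    (n : ℤ) : P n := by
  rcases n with n | n
  · exact h n
  · exact h' n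

/-- In negative degree x meets a y, and xy = σ(a) leaves a coefficient behind. The same factors
define `shiftX` and `shiftY`. -/
lemma x_mul_monomial (n : ℤ) :
    x σ a * monomial σ a n = coeff σ a (if 0 ≤ n then 1 else σ a) * monomial σ a (n + 1) := by
  induction n using int_cases with
  | h n =>
    rw [if_pos (by lia), map_one, one_mul, ← Nat.cast_succ, monomial_natCast, monomial_natCast,
      pow_succ']
  | h' n =>
    rw [if_neg (by lia), monomial_neg_natCast,
      show -((n + 1 : ℕ) : ℤ) + 1 = -(n : ℤ) by lia, monomial_neg_natCast, pow_succ', ← mul_assoc,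
      x_mul_y]

lemma y_mul_monomial (n : ℤ) :
    y σ a * monomial σ a n = coeff σ a (if n ≤ 0 then 1 else a) * monomial σ a (n - 1) := by
  induction n using int_cases with
  | h n =>
    rcases n with _ | n
    · rw [if_pos (by lia), map_one, one_mul, show ((0 : ℕ) : ℤ) - 1 = -((1 : ℕ) : ℤ) by lia,
        monomial_neg_natCast, monomial_natCast]
      simp
    · rw [if_neg (by lia), show ((n + 1 : ℕ) : ℤ) - 1 = n by lia, monomial_natCast,
        monomial_natCast, pow_succ', ← mul_assoc, y_mul_x]
  | h' n =>
    rw [if_pos (by lia), monomial_neg_natCast,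
      show -((n + 1 : ℕ) : ℤ) - 1 = -((n + 2 : ℕ) : ℤ) by lia, monomial_neg_natCast, map_one,
      one_mul, pow_succ' _ (n + 1)]

lemma exists_monomial_mul_coeff (n : ℤ) (r : R) :
    ∃ s, monomial σ a n * coeff σ a r = coeff σ a s * monomial σ a n := by
  induction n using int_cases with
  | h n =>
    rw [monomial_natCast]
    induction n generalizing r with
    | zero => exact ⟨r, by simp⟩
    | succ n ih =>
      obtain ⟨s, hs⟩ := ih (σ r)
      exact ⟨s, by rw [pow_succ, mul_assoc, x_mul_coeff, ← mul_assoc, hs, mul_assoc]⟩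
  | h' n =>
    rw [monomial_neg_natCast]
    induction n + 1 generalizing r with
    | zero => exact ⟨r, by simp⟩
    | succ n ih =>
      obtain ⟨s, hs⟩ := ih (σ.symm r)
      refine ⟨s, ?_⟩
      rw [pow_succ, mul_assoc, ← mul_assoc (coeff σ a s), ← hs, mul_assoc, coeff_mul_y,
        σ.apply_symm_apply]

lemma monomial_mul_x_of_nonneg {n : ℤ} (hn : 0 ≤ n) :
    monomial σ a n * x σ a = monomial σ a (n + 1) := by
  lift n to ℕ using hn
  rw [← Nat.cast_succ, monomial_natCast, monomial_natCast, pow_succ]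

lemma monomial_mul_y_of_nonpos {n : ℤ} (hn : n ≤ 0) :
    monomial σ a n * y σ a = monomial σ a (n - 1) := by
  obtain ⟨n, rfl⟩ : ∃ m : ℕ, n = -(m : ℤ) := ⟨(-n).toNat, by lia⟩
  rw [show -(n : ℤ) - 1 = -((n + 1 : ℕ) : ℤ) by lia, monomial_neg_natCast, monomial_neg_natCast,
    pow_succ]

lemma exists_monomial_mul_x (n : ℤ) :
    ∃ s, monomial σ a n * x σ a = coeff σ a s * monomial σ a (n + 1) := by
  rcases le_or_gt 0 n with hn | hn
  · exact ⟨1, by rw [monomial_mul_x_of_nonneg σ a hn, map_one, one_mul]⟩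
  · obtain ⟨s, hs⟩ := exists_monomial_mul_coeff σ a (n + 1) a
    refine ⟨s, ?_⟩
    nth_rw 1 [← add_sub_cancel_right n 1]
    rw [← monomial_mul_y_of_nonpos σ a (by lia : n + 1 ≤ 0), mul_assoc, y_mul_x, hs]

lemma exists_monomial_mul_y (n : ℤ) :
    ∃ s, monomial σ a n * y σ a = coeff σ a s * monomial σ a (n - 1) := by
  rcases le_or_gt n 0 with hn | hn
  · exact ⟨1, by rw [monomial_mul_y_of_nonpos σ a hn, map_one, one_mul]⟩
  · obtain ⟨s, hs⟩ := exists_monomial_mul_coeff σ a (n - 1) (σ a)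
    refine ⟨s, ?_⟩
    nth_rw 1 [← sub_add_cancel n 1]
    rw [← monomial_mul_x_of_nonneg σ a (by lia : 0 ≤ n - 1), mul_assoc, x_mul_y, hs]

/-- Left multiplication by `x` on the free module spanned by the monomials. -/
noncomputable def shiftX : Module.End k (ℤ →₀ R) :=
  Finsupp.lsum k fun n => Finsupp.lsingle (n + 1) ∘ₗ
    LinearMap.mulRight k (if 0 ≤ n then 1 else σ a) ∘ₗ σ.toLinearMap

/-- Left multiplication by `y` on the free module spanned by the monomials. -/
noncomputable def shiftY : Module.End k (ℤ →₀ R) :=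
  Finsupp.lsum k fun n => Finsupp.lsingle (n - 1) ∘ₗ
    LinearMap.mulRight k (if n ≤ 0 then 1 else a) ∘ₗ σ.symm.toLinearMap

@[simp]
lemma shiftX_single (n : ℤ) (r : R) : shiftX σ a (Finsupp.single n r) =
    Finsupp.single (n + 1) (σ r * if 0 ≤ n then 1 else σ a) := by
  simp [shiftX]

@[simp]
lemma shiftY_single (n : ℤ) (r : R) : shiftY σ a (Finsupp.single n r) =
    Finsupp.single (n - 1) (σ.symm r * if n ≤ 0 then 1 else a) := by
  simp [shiftY]

/-- The left regular representation of the Bavula algebra, in coordinates. -/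
noncomputable def regularRep : BavulaAlgebra k σ a →ₐ[k] Module.End k (ℤ →₀ R) :=
  lift σ a (Algebra.lsmul k k (ℤ →₀ R)) (shiftX σ a) (shiftY σ a)
    (by
      ext n r : 2
      rcases le_or_gt 0 n with hn | hn
      · simp [hn, show ¬ n + 1 ≤ 0 by lia, mul_comm, -Finsupp.single_mul]
      · simp [not_le.2 hn, show n + 1 ≤ 0 by lia, mul_comm, -Finsupp.single_mul])
    (by
      ext n r : 2
      rcases le_or_gt n 0 with hn | hn
      · simp [hn, show ¬ 1 ≤ n by lia, mul_comm, -Finsupp.single_mul]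
      · simp [not_le.2 hn, show 1 ≤ n by lia, mul_comm, -Finsupp.single_mul])
    (by intro r; ext n s : 2; simp [mul_assoc, -Finsupp.single_mul])
    (by intro r; ext n s : 2; simp [mul_assoc, -Finsupp.single_mul])

/-- The coordinates of an element in the basis of the monomials. -/
noncomputable def coords : BavulaAlgebra k σ a →+ (ℤ →₀ R) where
  toFun z := regularRep σ a z (Finsupp.single 0 1)
  map_zero' := by simp
  map_add' z w := by simp

lemma coords_coeff_mul (r : R) (z : BavulaAlgebra k σ a) :
    coords σ a (coeff σ a r * z) = r • coords σ a z := by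
  simp [coords, regularRep]

@[simp]
lemma coords_monomial (n : ℤ) : coords σ a (monomial σ a n) = Finsupp.single n 1 := by
  induction n using int_cases with
  | h n =>
    induction n with
    | zero => simp [coords]
    | succ n ih =>
      rw [monomial_natCast] at ih ⊢
      change regularRep σ a _ _ = _ at ih
      change regularRep σ a _ _ = _
      rw [pow_succ', map_mul, Module.End.mul_apply, ih]
      simp [regularRep]
  | h' n =>
    rw [monomial_neg_natCast]
    change regularRep σ a _ _ = _
    induction n + 1 with
    | zero => simp
    | succ n ih =>
      rw [pow_succ', map_mul, Module.End.mul_apply, ih]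
      simp [regularRep, sub_eq_add_neg, add_comm]

@[simp]
lemma coords_coeff_mul_monomial (r : R) (n : ℤ) :
    coords σ a (coeff σ a r * monomial σ a n) = Finsupp.single n r := by
  simp [coords_coeff_mul]

variable {σ a} in
@[elab_as_elim]
lemma monomial_induction {P : BavulaAlgebra k σ a → Prop}
    (h : ∀ r n, P (coeff σ a r * monomial σ a n)) (hadd : ∀ z w, P z → P w → P (z + w))
    (z : BavulaAlgebra k σ a) : P z := by
  let S := AddSubmonoid.closure
    (Set.range fun i : R × ℤ => coeff σ a i.1 * monomial σ a i.2)
  have hS (r : R) (n : ℤ) : coeff σ a r * monomial σ a n ∈ S :=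
    AddSubmonoid.subset_closure ⟨(r, n), rfl⟩
  -- S is stable under left multiplication by the generators, hence by every element; since it
  -- contains 1, it is everything.
  have key (z : BavulaAlgebra k σ a) : ∀ w ∈ S, z * w ∈ S := by
    induction z using induction with
    | hadd z w hz hw => intro v hv; rw [add_mul]; exact S.add_mem (hz v hv) (hw v hv)
    | hmul z w hz hw => intro v hv; rw [mul_assoc]; exact hz _ (hw v hv)
    | hcoeff r =>
      intro w hw
      induction hw using AddSubmonoid.closure_induction with
      | zero => rw [mul_zero]; exact S.zero_mem
      | add v w _ _ hv hw => rw [mul_add]; exact S.add_mem hv hw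
      | mem w hw =>
        obtain ⟨⟨s, n⟩, rfl⟩ := hw
        dsimp only
        rw [← mul_assoc, ← map_mul]
        exact hS _ _
    | hx =>
      intro w hw
      induction hw using AddSubmonoid.closure_induction with
      | zero => rw [mul_zero]; exact S.zero_mem
      | add v w _ _ hv hw => rw [mul_add]; exact S.add_mem hv hw
      | mem w hw =>
        obtain ⟨⟨s, n⟩, rfl⟩ := hw
        dsimp only
        rw [← mul_assoc, x_mul_coeff, mul_assoc, x_mul_monomial, ← mul_assoc, ← map_mul]
        exact hS _ _
    | hy =>
      intro w hw
      induction hw using AddSubmonoid.closure_induction with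
      | zero => rw [mul_zero]; exact S.zero_mem
      | add v w _ _ hv hw => rw [mul_add]; exact S.add_mem hv hw
      | mem w hw =>
        obtain ⟨⟨s, n⟩, rfl⟩ := hw
        dsimp only
        rw [← σ.apply_symm_apply s, ← mul_assoc, ← coeff_mul_y, mul_assoc, y_mul_monomial,
          ← mul_assoc, ← map_mul]
        exact hS _ _
  have hz : z ∈ S := by simpa using key z _ (hS 1 0)
  induction hz using AddSubmonoid.closure_induction with
  | zero => simpa using h 0 0
  | add z w _ _ hz hw => exact hadd z w hz hw
  | mem w hw =>
    obtain ⟨⟨s, n⟩, rfl⟩ := hw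
    exact h s n

/-- The monomials span, so rebuilding an element from its coordinates is a left inverse. -/
lemma coords_injective : Function.Injective (coords (k := k) σ a) := by
  let θ : (ℤ →₀ R) →+ BavulaAlgebra k σ a := Finsupp.liftAddHom fun n =>
    (AddMonoidHom.mulRight (monomial σ a n)).comp (coeff σ a : R →+ BavulaAlgebra k σ a)
  refine Function.LeftInverse.injective (g := θ) fun z => ?_
  induction z using monomial_induction with
  | h r n => simp [θ]
  | hadd z w hz hw => rw [map_add, map_add, hz, hw]

/-- The coefficient of degree zero. -/
noncomputable def constCoeff : BavulaAlgebra k σ a →+ R :=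
  (Finsupp.applyAddHom 0).comp (coords σ a)

lemma constCoeff_coeff_mul_monomial (r : R) (n : ℤ) :
    constCoeff σ a (coeff σ a r * monomial σ a n) = if n = 0 then r else 0 := by
  simp [constCoeff, Finsupp.single_apply]

lemma constCoeff_coeff (r : R) : constCoeff σ a (coeff σ a r) = r := by
  simpa using constCoeff_coeff_mul_monomial σ a r 0

lemma constCoeff_coeff_mul (r : R) (z : BavulaAlgebra k σ a) :
    constCoeff σ a (coeff σ a r * z) = r * constCoeff σ a z := by
  simp [constCoeff, coords_coeff_mul]

lemma constCoeff_mul_coeff (r : R) (z : BavulaAlgebra k σ a) :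
    constCoeff σ a (z * coeff σ a r) = constCoeff σ a z * r := by
  induction z using monomial_induction with
  | hadd z w hz hw => rw [add_mul, map_add, map_add, hz, hw, add_mul]
  | h s n =>
    by_cases hn : n = 0
    · subst hn
      rw [monomial_zero, mul_one, ← map_mul, constCoeff_coeff, constCoeff_coeff]
    · obtain ⟨t, ht⟩ := exists_monomial_mul_coeff σ a n r
      rw [mul_assoc, ht, ← mul_assoc, ← map_mul, constCoeff_coeff_mul_monomial,
        constCoeff_coeff_mul_monomial, if_neg hn, if_neg hn, zero_mul]

/-- Only the degree -1 term of z contributes, and there xy = σ(a) appears. -/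
lemma dvd_constCoeff_x_mul (z : BavulaAlgebra k σ a) : σ a ∣ constCoeff σ a (x σ a * z) := by
  induction z using monomial_induction with
  | hadd z w hz hw => rw [mul_add, map_add]; exact dvd_add hz hw
  | h s n =>
    rw [← mul_assoc, x_mul_coeff, mul_assoc, x_mul_monomial, ← mul_assoc, ← map_mul,
      constCoeff_coeff_mul_monomial]
    by_cases hn : n + 1 = 0
    · rw [if_pos hn, if_neg (by lia)]
      exact dvd_mul_left _ _
    · rw [if_neg hn]
      exact dvd_zero _

lemma dvd_constCoeff_mul_y (z : BavulaAlgebra k σ a) : σ a ∣ constCoeff σ a (z * y σ a) := by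
  induction z using monomial_induction with
  | hadd z w hz hw => rw [add_mul, map_add]; exact dvd_add hz hw
  | h s n =>
    by_cases hn : n = 1
    · have : monomial σ a n = x σ a := by simp [hn, monomial]
      rw [mul_assoc, this, x_mul_y, ← map_mul, constCoeff_coeff]
      exact dvd_mul_left _ _
    · obtain ⟨t, ht⟩ := exists_monomial_mul_y σ a n
      rw [mul_assoc, ht, ← mul_assoc, ← map_mul, constCoeff_coeff_mul_monomial, if_neg (by lia)]
      exact dvd_zero _

/-- The elements all of whose terms have nonnegative degree. -/
noncomputable def nonneg : AddSubgroup (BavulaAlgebra k σ a) where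
  carrier := {z | ∀ n < 0, coords σ a z n = 0}
  zero_mem' := by simp
  add_mem' hz hw n hn := by simp [hz n hn, hw n hn]
  neg_mem' hz n hn := by simp [hz n hn]

/-- The elements all of whose terms have nonpositive degree. -/
noncomputable def nonpos : AddSubgroup (BavulaAlgebra k σ a) where
  carrier := {z | ∀ n > 0, coords σ a z n = 0}
  zero_mem' := by simp
  add_mem' hz hw n hn := by simp [hz n hn, hw n hn]
  neg_mem' hz n hn := by simp [hz n hn]

variable {σ a}

lemma coeff_mul_monomial_mem_nonneg (r : R) {n : ℤ} (hn : 0 ≤ n) :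
    coeff σ a r * monomial σ a n ∈ nonneg σ a := fun m hm => by
  simp [(hm.trans_le hn).ne']

lemma coeff_mul_monomial_mem_nonpos (r : R) {n : ℤ} (hn : n ≤ 0) :
    coeff σ a r * monomial σ a n ∈ nonpos σ a := fun m hm => by
  simp [(hn.trans_lt hm).ne]

lemma coords_mul_coeff_eq_zero (r : R) {n : ℤ} (z : BavulaAlgebra k σ a)
    (hz : coords σ a z n = 0) : coords σ a (z * coeff σ a r) n = 0 := by
  -- Vanishing of a coordinate does not pass to summands, so the induction needs an additive
  -- identity instead.
  suffices ∃ f : R →+ R, ∀ z : BavulaAlgebra k σ a,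
      coords σ a (z * coeff σ a r) n = f (coords σ a z n) by
    obtain ⟨f, hf⟩ := this
    rw [hf, hz, map_zero]
  obtain ⟨t, ht⟩ := exists_monomial_mul_coeff σ a n r
  refine ⟨AddMonoidHom.mulRight t, fun z => ?_⟩
  induction z using monomial_induction with
  | hadd z w hz hw => simp only [add_mul, map_add, Finsupp.add_apply, hz, hw]
  | h s m =>
    by_cases hm : m = n
    · subst hm
      rw [mul_assoc, ht, ← mul_assoc, ← map_mul, coords_coeff_mul_monomial,
        coords_coeff_mul_monomial]
      simp
    · obtain ⟨t', ht'⟩ := exists_monomial_mul_coeff σ a m r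
      rw [mul_assoc, ht', ← mul_assoc, ← map_mul, coords_coeff_mul_monomial,
        coords_coeff_mul_monomial]
      simp [hm]

lemma mul_coeff_mem_nonneg {z : BavulaAlgebra k σ a} (hz : z ∈ nonneg σ a) (r : R) :
    z * coeff σ a r ∈ nonneg σ a := fun n hn => coords_mul_coeff_eq_zero r z (hz n hn)

lemma mul_coeff_mem_nonpos {z : BavulaAlgebra k σ a} (hz : z ∈ nonpos σ a) (r : R) :
    z * coeff σ a r ∈ nonpos σ a := fun n hn => coords_mul_coeff_eq_zero r z (hz n hn)

lemma exists_eq_add_mul_y (z : BavulaAlgebra k σ a) :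
    ∃ p ∈ nonneg σ a, ∃ q ∈ nonpos σ a, z = p + q * y σ a := by
  induction z using monomial_induction with
  | hadd z w hz hw =>
    obtain ⟨p, hp, q, hq, rfl⟩ := hz
    obtain ⟨p', hp', q', hq', rfl⟩ := hw
    exact ⟨p + p', add_mem hp hp', q + q', add_mem hq hq', by rw [add_mul]; abel⟩
  | h r n =>
    rcases le_or_gt 0 n with hn | hn
    · exact ⟨_, coeff_mul_monomial_mem_nonneg r hn, 0, zero_mem _, by simp⟩
    · refine ⟨0, zero_mem _, _, coeff_mul_monomial_mem_nonpos r (by lia : n + 1 ≤ 0), ?_⟩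
      rw [mul_assoc, monomial_mul_y_of_nonpos σ a (by lia), add_sub_cancel_right, zero_add]

lemma exists_eq_mul_x_add (z : BavulaAlgebra k σ a) :
    ∃ p ∈ nonneg σ a, ∃ q ∈ nonpos σ a, z = p * x σ a + q := by
  induction z using monomial_induction with
  | hadd z w hz hw =>
    obtain ⟨p, hp, q, hq, rfl⟩ := hz
    obtain ⟨p', hp', q', hq', rfl⟩ := hw
    exact ⟨p + p', add_mem hp hp', q + q', add_mem hq hq', by rw [add_mul]; abel⟩
  | h r n =>
    rcases le_or_gt n 0 with hn | hn
    · exact ⟨0, zero_mem _, _, coeff_mul_monomial_mem_nonpos r hn, by simp⟩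
    · refine ⟨_, coeff_mul_monomial_mem_nonneg r (by lia : 0 ≤ n - 1), 0, zero_mem _, ?_⟩
      rw [mul_assoc, monomial_mul_x_of_nonneg σ a (by lia), sub_add_cancel, add_zero]

lemma coords_mul_x (z : BavulaAlgebra k σ a) {n : ℤ} (hn : 0 ≤ n) :
    coords σ a (z * x σ a) (n + 1) = coords σ a z n := by
  induction z using monomial_induction with
  | hadd z w hz hw => simp only [add_mul, map_add, Finsupp.add_apply, hz, hw]
  | h r m =>
    by_cases hm : m = n
    · subst hm
      rw [mul_assoc, monomial_mul_x_of_nonneg σ a hn, coords_coeff_mul_monomial,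
        coords_coeff_mul_monomial]
      simp
    · obtain ⟨t, ht⟩ := exists_monomial_mul_x σ a m
      rw [mul_assoc, ht, ← mul_assoc, ← map_mul, coords_coeff_mul_monomial,
        coords_coeff_mul_monomial]
      simp [hm]

lemma coords_mul_y (z : BavulaAlgebra k σ a) {n : ℤ} (hn : n ≤ 0) :
    coords σ a (z * y σ a) (n - 1) = coords σ a z n := by
  induction z using monomial_induction with
  | hadd z w hz hw => simp only [add_mul, map_add, Finsupp.add_apply, hz, hw]
  | h r m =>
    by_cases hm : m = n
    · subst hm
      rw [mul_assoc, monomial_mul_y_of_nonpos σ a hn, coords_coeff_mul_monomial,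
        coords_coeff_mul_monomial]
      simp
    · obtain ⟨t, ht⟩ := exists_monomial_mul_y σ a m
      rw [mul_assoc, ht, ← mul_assoc, ← map_mul, coords_coeff_mul_monomial,
        coords_coeff_mul_monomial]
      simp [hm]

lemma eq_zero_of_mul_x_mem_nonpos {z : BavulaAlgebra k σ a} (hz : z ∈ nonneg σ a)
    (h : z * x σ a ∈ nonpos σ a) : z = 0 := by
  refine coords_injective σ a (Finsupp.ext fun n => ?_)
  rw [map_zero, Finsupp.zero_apply]
  rcases le_or_gt 0 n with hn | hn
  · rw [← coords_mul_x z hn]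
    exact h _ (by lia)
  · exact hz n hn

lemma eq_zero_of_mul_y_mem_nonneg {z : BavulaAlgebra k σ a} (hz : z ∈ nonpos σ a)
    (h : z * y σ a ∈ nonneg σ a) : z = 0 := by
  refine coords_injective σ a (Finsupp.ext fun n => ?_)
  rw [map_zero, Finsupp.zero_apply]
  rcases le_or_gt n 0 with hn | hn
  · rw [← coords_mul_y z hn]
    exact h _ (by lia)
  · exact hz n hn

end NormalForm

end BavulaAlgebra

/-! ### Dimension shifting and periodic complexes -/

section Homological

open CategoryTheory

variable {A : Type u} [Ring A]

/-- Passing from the range of a linear map to its kernel shifts the projective dimension. -/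
lemma hasProjectiveDimensionLT_ker {P Q : Type u} [AddCommGroup P] [Module A P] [AddCommGroup Q]
    [Module A Q] [Module.Projective A P] (f : P →ₗ[A] Q) (n : ℕ) :
    HasProjectiveDimensionLT (ModuleCat.of A (LinearMap.range f)) (n + 2) ↔
      HasProjectiveDimensionLT (ModuleCat.of A (LinearMap.ker f)) (n + 1) := by
  let S : ShortComplex (ModuleCat.{u} A) := ShortComplex.mk
    (ModuleCat.ofHom (LinearMap.ker f).subtype) (ModuleCat.ofHom f.rangeRestrict)
    (ModuleCat.hom_ext (LinearMap.ext fun z => Subtype.ext (LinearMap.mem_ker.1 z.2)))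
  have hS : S.ShortExact :=
    { exact := (ShortComplex.ShortExact.moduleCat_exact_iff_function_exact S).2 fun z => by
        constructor
        · intro hz
          exact ⟨⟨z, congrArg Subtype.val hz⟩, rfl⟩
        · rintro ⟨w, rfl⟩
          exact Subtype.ext (LinearMap.mem_ker.1 w.2)
      mono_f := (ModuleCat.mono_iff_injective _).2 Subtype.val_injective
      epi_g := (ModuleCat.epi_iff_surjective _).2 f.surjective_rangeRestrict }
  have hP : Projective (ModuleCat.of A P) := (IsProjective.iff_projective P).1 inferInstance
  exact hS.hasProjectiveDimensionLT_X₃_iff n hP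

lemma hasProjectiveDimensionLT_of_surjective {P Q : Type u} [AddCommGroup P] [Module A P]
    [AddCommGroup Q] [Module A Q] [Module.Projective A P] (f : P →ₗ[A] Q)
    (hf : Function.Surjective f) (n : ℕ)
    (h : HasProjectiveDimensionLT (ModuleCat.of A (LinearMap.ker f)) (n + 1)) :
    HasProjectiveDimensionLT (ModuleCat.of A Q) (n + 2) := by
  rw [← hasProjectiveDimensionLT_ker, LinearMap.range_eq_top.2 hf] at h
  exact hasProjectiveDimensionLT_of_iso
    (Submodule.topEquiv (R := A) (M := Q)).toModuleIso (n + 2)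

/-- Over a ring of finite global dimension, an acyclic periodic complex is contractible. -/
lemma exists_comp_comp_eq_self {P : Type u} [AddCommGroup P] [Module A P] [Module.Projective A P]
    (φ ψ : P →ₗ[A] P) (h₁ : LinearMap.ker φ = LinearMap.range ψ)
    (h₂ : LinearMap.ker ψ = LinearMap.range φ) (n : ℕ)
    (hA : ∀ M : ModuleCat.{u} A, HasProjectiveDimensionLT M (n + 1)) :
    ∃ s : P →ₗ[A] P, φ ∘ₗ s ∘ₗ φ = φ := by
  have key : HasProjectiveDimensionLT (ModuleCat.of A (LinearMap.range φ)) 1 ∧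
      HasProjectiveDimensionLT (ModuleCat.of A (LinearMap.range ψ)) 1 := by
    have : HasProjectiveDimensionLT (ModuleCat.of A (LinearMap.range φ)) (n + 1) ∧
      HasProjectiveDimensionLT (ModuleCat.of A (LinearMap.range ψ)) (n + 1) := ⟨hA _, hA _⟩
    clear hA
    induction n with
    | zero => exact this
    | succ n ih =>
      -- Each image is the syzygy of the other, so every shift lowers both bounds by one and swaps
      -- them.
      rw [hasProjectiveDimensionLT_ker, hasProjectiveDimensionLT_ker, h₁, h₂] at this
      exact ih this.symm
  have := (IsProjective.iff_projective (LinearMap.range φ)).2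
    (projective_iff_hasProjectiveDimensionLT_one.2 key.1)
  have := (IsProjective.iff_projective (LinearMap.range ψ)).2
    (projective_iff_hasProjectiveDimensionLT_one.2 key.2)
  obtain ⟨s, hs⟩ := Module.projective_lifting_property φ.rangeRestrict LinearMap.id
    φ.surjective_rangeRestrict
  obtain ⟨t, ht⟩ := Module.projective_lifting_property ψ.rangeRestrict LinearMap.id
    ψ.surjective_rangeRestrict
  -- Thus `id - tψ` is a projection of P onto ker ψ = im φ; it extends the section s of φ from im φ
  -- to P.
  have ht' (z : P) : z - t (ψ.rangeRestrict z) ∈ LinearMap.range φ := by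
    rw [← h₂, LinearMap.mem_ker, map_sub, sub_eq_zero]
    exact congrArg Subtype.val (LinearMap.congr_fun ht (ψ.rangeRestrict z)).symm
  refine ⟨s ∘ₗ LinearMap.codRestrict _ (LinearMap.id - t ∘ₗ ψ.rangeRestrict) ht', ?_⟩
  ext z
  have hz : ψ (φ z) = 0 := by
    rw [← LinearMap.mem_ker, h₂]
    exact ⟨z, rfl⟩
  have hz' : ψ.rangeRestrict (φ z) = 0 := Subtype.ext hz
  have := congrArg Subtype.val (LinearMap.congr_fun hs ⟨φ z, z, rfl⟩)
  have hc : LinearMap.codRestrict _ (LinearMap.id - t ∘ₗ ψ.rangeRestrict) ht' (φ z) =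
      ⟨φ z, LinearMap.mem_range_self φ z⟩ := Subtype.ext (by
    change φ z - t (ψ.rangeRestrict (φ z)) = φ z
    rw [hz', map_zero, sub_zero])
  simp only [LinearMap.comp_apply, hc]
  exact this

/-- A finite supremum is a bound uniform in the module; the bound n on the projective dimension is
`HasProjectiveDimensionLT` at n + 1. -/
lemma leftGlobalDimension_lt_top_iff :
    leftGlobalDimension A < ⊤ ↔
      ∃ n : ℕ, ∀ M : ModuleCat.{u} A, HasProjectiveDimensionLT M (n + 1) := by
  constructor
  · intro h
    obtain ⟨n, hn⟩ : ∃ n : ℕ, leftGlobalDimension A ≤ n := by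
      generalize leftGlobalDimension A = d at h
      induction d with
      | bot => exact ⟨0, bot_le⟩
      | coe d =>
        induction d with
        | top => exact absurd h (lt_irrefl _)
        | coe d => exact ⟨d, le_rfl⟩
    exact ⟨n, fun M => (projectiveDimension_le_iff M n).1 ((le_iSup _ M).trans hn)⟩
  · rintro ⟨n, hn⟩
    refine lt_of_le_of_lt (b := (n : WithBot ℕ∞))
      (iSup_le fun M => (projectiveDimension_le_iff M n).2 (hn M)) ?_
    exact WithBot.coe_lt_coe.2 (ENat.natCast_lt_top n)

end Homological

namespace BavulaAlgebra

/-! ### Necessity: the periodic complex of a repeated factor -/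

section Periodic

variable {k : Type u} {R : Type v} [CommRing k] [CommRing R] [Algebra k R]
variable (σ : R ≃ₐ[k] R) (p b : R)

/-- The first differential of the periodic complex given by the factorization `a = p (p b)`. -/
noncomputable def periodicMap (a : R) :
    (BavulaAlgebra k σ a × BavulaAlgebra k σ a) →ₗ[BavulaAlgebra k σ a]
      (BavulaAlgebra k σ a × BavulaAlgebra k σ a) where
  toFun z := (z.1 * x σ a + z.2 * coeff σ a (p * b), z.1 * coeff σ a (σ p) + z.2 * y σ a)
  map_add' z w := by ext <;> simp [add_mul] <;> abel
  map_smul' c z := by ext <;> simp [mul_assoc, mul_add]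

/-- The second differential of the periodic complex given by the factorization `a = p (p b)`. -/
noncomputable def periodicMap' (a : R) :
    (BavulaAlgebra k σ a × BavulaAlgebra k σ a) →ₗ[BavulaAlgebra k σ a]
      (BavulaAlgebra k σ a × BavulaAlgebra k σ a) where
  toFun z := (z.1 * y σ a - z.2 * coeff σ a (σ (p * b)), z.2 * x σ a - z.1 * coeff σ a p)
  map_add' z w := by ext <;> simp [add_mul] <;> abel
  map_smul' c z := by ext <;> simp [mul_assoc, mul_sub]

variable {a : R}

lemma periodicMap_periodicMap' (ha : a = p * (p * b))
    (z : BavulaAlgebra k σ a × BavulaAlgebra k σ a) :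
    periodicMap σ p b a (periodicMap' σ p b a z) = 0 := by
  have h₁ : coeff σ a p * coeff σ a (p * b) = coeff σ a a := by rw [← map_mul, ← ha]
  have h₂ : coeff σ a (σ (p * b)) * coeff σ a (σ p) = coeff σ a (σ a) := by
    rw [← map_mul, ← map_mul, mul_comm, ← ha]
  ext
  · simp only [periodicMap, periodicMap', LinearMap.coe_mk, AddHom.coe_mk, sub_mul,
      mul_assoc, y_mul_x, x_mul_coeff, h₁, Prod.fst_zero]
    abel
  · simp only [periodicMap, periodicMap', LinearMap.coe_mk, AddHom.coe_mk, sub_mul,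
      mul_assoc, x_mul_y, coeff_mul_y, h₂, Prod.snd_zero]
    abel

lemma periodicMap'_periodicMap (ha : a = p * (p * b))
    (z : BavulaAlgebra k σ a × BavulaAlgebra k σ a) :
    periodicMap' σ p b a (periodicMap σ p b a z) = 0 := by
  have h₁ : coeff σ a (p * b) * coeff σ a p = coeff σ a a := by rw [← map_mul, mul_comm, ← ha]
  have h₂ : coeff σ a (σ p) * coeff σ a (σ (p * b)) = coeff σ a (σ a) := by
    rw [← map_mul, ← map_mul, ← ha]
  ext
  · simp only [periodicMap, periodicMap', LinearMap.coe_mk, AddHom.coe_mk, add_mul,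
      mul_assoc, x_mul_y, coeff_mul_y, h₂, Prod.fst_zero]
    abel
  · simp only [periodicMap, periodicMap', LinearMap.coe_mk, AddHom.coe_mk, add_mul,
      mul_assoc, y_mul_x, x_mul_coeff, h₁, Prod.snd_zero]
    abel

/-- Modulo the image, a pair can be moved to (r, s) with r in degrees ≥ 0 and s in degrees ≤ 0. If
such a pair is in the kernel, rx has positive degrees but equals -s(pb), of degrees ≤ 0, so r = 0;
likewise s = 0. -/
lemma ker_periodicMap (ha : a = p * (p * b)) :
    LinearMap.ker (periodicMap σ p b a) = LinearMap.range (periodicMap' σ p b a) := by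
  refine le_antisymm ?_ ?_
  · rintro ⟨u, v⟩ h
    obtain ⟨u₁, hu₁, u', hu', rfl⟩ := exists_eq_add_mul_y u
    obtain ⟨v', hv', v₁, hv₁, rfl⟩ := exists_eq_mul_x_add v
    set r := u₁ + v' * coeff σ a (σ (p * b))
    set s := v₁ + u' * coeff σ a p
    have hr' : r ∈ nonneg σ a := add_mem hu₁ (mul_coeff_mem_nonneg hv' _)
    have hs' : s ∈ nonpos σ a := add_mem hv₁ (mul_coeff_mem_nonpos hu' _)
    have heq : (u₁ + u' * y σ a, v' * x σ a + v₁) =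
        periodicMap' σ p b a (u', v') + (r, s) := by
      ext
      · change _ = u' * y σ a - v' * coeff σ a (σ (p * b)) + (u₁ + v' * coeff σ a (σ (p * b)))
        rw [sub_add_add_cancel, add_comm]
      · change _ = v' * x σ a - u' * coeff σ a p + (v₁ + u' * coeff σ a p)
        rw [sub_add_add_cancel]
    rw [LinearMap.mem_ker, heq, map_add, periodicMap_periodicMap' σ p b ha, zero_add] at h
    have h₁ : r * x σ a + s * coeff σ a (p * b) = 0 := congrArg Prod.fst h
    have h₂ : r * coeff σ a (σ p) + s * y σ a = 0 := congrArg Prod.snd h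
    have hr0 : r = 0 := eq_zero_of_mul_x_mem_nonpos hr' (by
      rw [eq_neg_of_add_eq_zero_left h₁]
      exact neg_mem (mul_coeff_mem_nonpos hs' _))
    have hs0 : s = 0 := eq_zero_of_mul_y_mem_nonneg hs' (by
      rw [eq_neg_of_add_eq_zero_right h₂]
      exact neg_mem (mul_coeff_mem_nonneg hr' _))
    exact ⟨(u', v'), by rw [heq, hr0, hs0]; exact (add_zero _).symm⟩
  · rintro _ ⟨z, rfl⟩
    exact periodicMap_periodicMap' σ p b ha z

lemma ker_periodicMap' (ha : a = p * (p * b)) :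
    LinearMap.ker (periodicMap' σ p b a) = LinearMap.range (periodicMap σ p b a) := by
  refine le_antisymm ?_ ?_
  · rintro ⟨u, v⟩ h
    obtain ⟨u', hu', u₁, hu₁, rfl⟩ := exists_eq_mul_x_add u
    obtain ⟨v₁, hv₁, v', hv', rfl⟩ := exists_eq_add_mul_y v
    set r := u₁ - v' * coeff σ a (p * b)
    set s := v₁ - u' * coeff σ a (σ p)
    have hr' : r ∈ nonpos σ a := sub_mem hu₁ (mul_coeff_mem_nonpos hv' _)
    have hs' : s ∈ nonneg σ a := sub_mem hv₁ (mul_coeff_mem_nonneg hu' _)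
    have heq : (u' * x σ a + u₁, v₁ + v' * y σ a) =
        periodicMap σ p b a (u', v') + (r, s) := by
      ext
      · change _ = u' * x σ a + v' * coeff σ a (p * b) + (u₁ - v' * coeff σ a (p * b))
        rw [add_add_sub_cancel]
      · change _ = u' * coeff σ a (σ p) + v' * y σ a + (v₁ - u' * coeff σ a (σ p))
        rw [add_comm (u' * coeff σ a (σ p)), add_add_sub_cancel]
        exact add_comm _ _
    rw [LinearMap.mem_ker, heq, map_add, periodicMap'_periodicMap σ p b ha, zero_add] at h
    have h₁ : r * y σ a - s * coeff σ a (σ (p * b)) = 0 := congrArg Prod.fst h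
    have h₂ : s * x σ a - r * coeff σ a p = 0 := congrArg Prod.snd h
    have hr0 : r = 0 := eq_zero_of_mul_y_mem_nonneg hr' (by
      rw [sub_eq_zero.1 h₁]
      exact mul_coeff_mem_nonneg hs' _)
    have hs0 : s = 0 := eq_zero_of_mul_x_mem_nonpos hs' (by
      rw [sub_eq_zero.1 h₂]
      exact mul_coeff_mem_nonpos hr' _)
    exact ⟨(u', v'), by rw [heq, hr0, hs0]; exact (add_zero _).symm⟩
  · rintro _ ⟨z, rfl⟩
    exact periodicMap'_periodicMap σ p b ha z

/-- If the periodic complex is contractible, then `σ p` is divisible by its square. -/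
lemma mul_self_dvd_of_comp_comp_eq_self (ha : a = p * (p * b))
    (s : (BavulaAlgebra k σ a × BavulaAlgebra k σ a) →ₗ[BavulaAlgebra k σ a]
      (BavulaAlgebra k σ a × BavulaAlgebra k σ a))
    (hs : periodicMap σ p b a ∘ₗ s ∘ₗ periodicMap σ p b a = periodicMap σ p b a) :
    σ p * σ p ∣ σ p := by
  have h₀ : periodicMap σ p b a (1, 0) = x σ a • (1, 0) + coeff σ a (σ p) • (0, 1) := by
    ext <;> simp [periodicMap]
  have h := LinearMap.congr_fun hs (1, 0)
  rw [LinearMap.comp_apply, LinearMap.comp_apply, h₀, map_add, map_smul, map_smul] at h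
  generalize s (1, 0) = z at h
  generalize s (0, 1) = w at h
  replace h := congrArg (constCoeff σ a) (congrArg Prod.snd h)
  have hd : σ p * σ p ∣ σ a := ⟨σ b, by rw [ha]; simp [mul_assoc]⟩
  simp only [periodicMap, LinearMap.coe_mk, AddHom.coe_mk, Prod.snd_add,
    Prod.smul_fst, Prod.smul_snd, smul_eq_mul, mul_zero, mul_one, mul_assoc, map_add, zero_add,
    constCoeff_coeff, constCoeff_coeff_mul] at h
  -- The right side is now a sum of four terms: two begin with x, one ends with y, and in the
  -- remaining one σ(p) stands on both sides.
  nth_rw 3 [← h]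
  refine dvd_add (dvd_add (hd.trans (dvd_constCoeff_x_mul σ a _))
    (hd.trans (dvd_constCoeff_x_mul σ a _))) (dvd_add ?_ ?_)
  · rw [constCoeff_mul_coeff, mul_comm (constCoeff σ a _)]
    exact mul_dvd_mul_left _ (dvd_mul_right _ _)
  · exact (hd.trans (dvd_constCoeff_mul_y σ a _)).mul_left _

end Periodic

theorem isCoprime_of_leftGlobalDimension_lt_top {k : Type u} [Field k] [CharZero k]
    (σ : k[X] ≃ₐ[k] k[X]) (a : k[X]) (h : leftGlobalDimension (BavulaAlgebra k σ a) < ⊤) :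
    IsCoprime a (derivative a) := by
  obtain ⟨n, hn⟩ := leftGlobalDimension_lt_top_iff.1 h
  by_contra hsep
  obtain ⟨p, b, hp, hp0, ha⟩ : ∃ p b : k[X], ¬ IsUnit p ∧ p ≠ 0 ∧ a = p * (p * b) := by
    by_cases ha : a = 0
    -- For a = 0 any nonzero nonunit p serves.
    · exact ⟨X, 0, not_isUnit_X, X_ne_zero, by simp [ha]⟩
    · have : ¬ Squarefree a := fun hsq => hsep (PerfectField.separable_iff_squarefree.2 hsq)
      simp only [Squarefree, not_forall] at this
      obtain ⟨p, ⟨b, hb⟩, hp⟩ := this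
      exact ⟨p, b, hp, by rintro rfl; simp_all, by rw [hb, mul_assoc]⟩
  obtain ⟨s, hs⟩ := exists_comp_comp_eq_self _ _ (ker_periodicMap σ p b ha)
    (ker_periodicMap' σ p b ha) n hn
  obtain ⟨c, hc⟩ := mul_self_dvd_of_comp_comp_eq_self σ p b ha s hs
  have h0 : σ p ≠ 0 := by simpa using hp0
  rw [mul_assoc] at hc
  have hu : IsUnit (σ p) := IsUnit.of_mul_eq_one c (mul_left_cancel₀ h0 (by rw [← hc, mul_one]))
  exact hp ((isUnit_map_iff σ p).1 hu)

end BavulaAlgebra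

/-! ### Lifting extensions and splitting syzygies -/

section Sections

/-- If the extension `W` of `M` by `N` maps onto the projective module `F` compatibly with the maps
from `N` and to `M`, then the kernel of `F → M` is a direct summand of `N`. -/
lemma projective_ker_of_extension {A N F M W : Type*} [Ring A] [AddCommGroup N] [Module A N]
    [AddCommGroup F] [Module A F] [AddCommGroup M] [Module A M] [AddCommGroup W] [Module A W]
    [Module.Projective A F] [Module.Projective A N] (π : N →ₗ[A] F) (ε : F →ₗ[A] M)
    (i : N →ₗ[A] W) (p : W →ₗ[A] M) (ψ : W →ₗ[A] F) (hπ : ∀ n, ε (π n) = 0)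
    (hψi : ∀ n, ψ (i n) = π n) (hεψ : ∀ w, ε (ψ w) = p w) (hi : Function.Injective i)
    (hip : ∀ w, p w = 0 → ∃ n, i n = w) (hψ : Function.Surjective ψ) :
    Module.Projective A (LinearMap.ker ε) := by
  -- The section τ of ψ sends ker ε into ker p = im i. So i⁻¹τ maps ker ε to N, and π i⁻¹τ = ψτ is
  -- the identity there.
  obtain ⟨τ, hτ⟩ := Module.projective_lifting_property ψ LinearMap.id hψ
  have hτ' (f : F) : ψ (τ f) = f := LinearMap.congr_fun hτ f
  have hmem (κ : LinearMap.ker ε) : (τ ∘ₗ (LinearMap.ker ε).subtype) κ ∈ LinearMap.range i := by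
    apply hip
    change p (τ κ) = 0
    rw [← hεψ, hτ', LinearMap.mem_ker.1 κ.2]
  let ρ : LinearMap.ker ε →ₗ[A] N := (LinearEquiv.ofInjective i hi).symm ∘ₗ
    LinearMap.codRestrict (LinearMap.range i) (τ ∘ₗ (LinearMap.ker ε).subtype) hmem
  have hρ (κ : LinearMap.ker ε) : i (ρ κ) = τ κ :=
    congrArg Subtype.val (LinearEquiv.apply_symm_apply (LinearEquiv.ofInjective i hi)
      (LinearMap.codRestrict (LinearMap.range i) (τ ∘ₗ (LinearMap.ker ε).subtype) hmem κ))
  refine Module.Projective.of_split ρ (LinearMap.codRestrict _ π hπ) ?_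
  ext κ
  change π (ρ κ) = κ
  rw [← hψi, hρ, hτ']

/-- Both ε and N → ker ε split over S; the second splitting is extended to F along the projection
`id - sε`. It is used with S a subring over which the modules are simpler. -/
lemma exists_linear_sections {S N F M : Type*} [Ring S] [AddCommGroup N] [Module S N]
    [AddCommGroup F] [Module S F] [AddCommGroup M] [Module S M] (π : N →ₗ[S] F) (ε : F →ₗ[S] M)
    [Module.Projective S M] [Module.Projective S (LinearMap.ker ε)] (hε : Function.Surjective ε)
    (hπ : ∀ n, ε (π n) = 0) (hπε : ∀ f, ε f = 0 → ∃ n, π n = f) :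
    ∃ (s : M →ₗ[S] F) (t : F →ₗ[S] N), (∀ m, ε (s m) = m) ∧ ∀ f, ε f = 0 → π (t f) = f := by
  obtain ⟨s, hs⟩ := Module.projective_lifting_property ε LinearMap.id hε
  have hs' (m : M) : ε (s m) = m := LinearMap.congr_fun hs m
  obtain ⟨t, ht⟩ := Module.projective_lifting_property
    (LinearMap.codRestrict (LinearMap.ker ε) π hπ) LinearMap.id fun ⟨f, hf⟩ =>
      let ⟨n, hn⟩ := hπε f hf
      ⟨n, Subtype.ext hn⟩
  refine ⟨s, t ∘ₗ LinearMap.codRestrict (LinearMap.ker ε) (LinearMap.id - s ∘ₗ ε) (fun f => ?_),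
    hs', fun f hf => ?_⟩
  · simp [hs']
  · have h := congrArg Subtype.val (LinearMap.congr_fun ht ⟨f, hf⟩)
    have hc : LinearMap.codRestrict (LinearMap.ker ε) (LinearMap.id - s ∘ₗ ε)
        (fun f => by simp [hs']) f = ⟨f, hf⟩ := Subtype.ext (by simp [hf])
    rw [LinearMap.comp_apply, hc]
    exact h

/-- The elements of an algebra whose actions on two representations are intertwined by a given
linear map. -/
def intertwined {k A V V' : Type*} [CommRing k] [Ring A] [Algebra k A] [AddCommGroup V] [Module k V]
    [AddCommGroup V'] [Module k V'] (ρ : A →ₐ[k] Module.End k V) (ρ' : A →ₐ[k] Module.End k V')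
    (f : V →ₗ[k] V') : Subalgebra k A where
  carrier := {z | ∀ v, f (ρ z v) = ρ' z (f v)}
  mul_mem' hz hw v := by simp [hz _, hw _]
  add_mem' hz hw v := by simp [hz _, hw _]
  algebraMap_mem' c v := by simp

lemma intertwines_of_adjoin_eq_top {k A V V' : Type*} [CommRing k] [Ring A] [Algebra k A]
    [AddCommGroup V] [Module k V] [AddCommGroup V'] [Module k V'] {G : Set A}
    (hG : Algebra.adjoin k G = ⊤) (ρ : A →ₐ[k] Module.End k V) (ρ' : A →ₐ[k] Module.End k V')
    (f : V →ₗ[k] V') (h : ∀ z ∈ G, ∀ v, f (ρ z v) = ρ' z (f v)) (z : A) (v : V) :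
    f (ρ z v) = ρ' z (f v) := by
  have hz : z ∈ intertwined ρ ρ' f :=
    (hG.symm.le.trans (Algebra.adjoin_le (S := intertwined ρ ρ' f) h)) Algebra.mem_top
  exact hz v

/-- The module over an algebra that is defined by a representation. -/
@[nolint unusedArguments]
def RepModule {k A W : Type*} [CommRing k] [Ring A] [Algebra k A] [AddCommGroup W] [Module k W]
    (_ : A →ₐ[k] Module.End k W) : Type _ := W

instance {k A W : Type*} [CommRing k] [Ring A] [Algebra k A] [AddCommGroup W] [Module k W]
    (φ : A →ₐ[k] Module.End k W) : AddCommGroup (RepModule φ) := inferInstanceAs (AddCommGroup W)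

instance {k A W : Type*} [CommRing k] [Ring A] [Algebra k A] [AddCommGroup W] [Module k W]
    (φ : A →ₐ[k] Module.End k W) : Module A (RepModule φ) := Module.compHom W φ.toRingHom

/-- `projective_ker_of_extension` for an extension given by a representation on `N × M`. -/
lemma projective_ker_of_rep {k A N F M : Type*} [CommRing k] [Ring A] [Algebra k A] [AddCommGroup N]
    [Module k N] [Module A N] [IsScalarTower k A N] [AddCommGroup F] [Module k F] [Module A F]
    [IsScalarTower k A F] [AddCommGroup M] [Module k M] [Module A M] [IsScalarTower k A M]
    [Module.Projective A F] [Module.Projective A N] (π : N →ₗ[A] F) (ε : F →ₗ[A] M)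
    (s : M →ₗ[k] F) (φ : A →ₐ[k] Module.End k (N × M)) (hπ : ∀ n, ε (π n) = 0)
    (hs : ∀ m, ε (s m) = m) (hπε : ∀ f, ε f = 0 → ∃ n, π n = f)
    {G : Set A} (hG : Algebra.adjoin k G = ⊤) (h₁ : ∀ z ∈ G, ∀ n, φ z (n, 0) = (z • n, 0))
    (h₂ : ∀ z ∈ G, ∀ w, (φ z w).2 = z • w.2)
    (h₃ : ∀ z ∈ G, ∀ w, π (φ z w).1 + s (φ z w).2 = z • (π w.1 + s w.2)) :
    Module.Projective A (LinearMap.ker ε) := by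
  have h₁' := intertwines_of_adjoin_eq_top hG (Algebra.lsmul k k N) φ (LinearMap.inl k N M)
    fun z hz n => (h₁ z hz n).symm
  have h₂' := intertwines_of_adjoin_eq_top hG φ (Algebra.lsmul k k M) (LinearMap.snd k N M) h₂
  have h₃' := intertwines_of_adjoin_eq_top hG φ (Algebra.lsmul k k F)
    (LinearMap.coprod (π.restrictScalars k) s) h₃
  let i : N →ₗ[A] RepModule φ :=
    { toFun := fun n => ((n, 0) : N × M)
      map_add' := map_add (LinearMap.inl k N M)
      map_smul' := h₁' }
  let p : RepModule φ →ₗ[A] M :=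
    { toFun := fun w => Prod.snd (α := N) (β := M) w
      map_add' := map_add (LinearMap.snd k N M)
      map_smul' := h₂' }
  let ψ : RepModule φ →ₗ[A] F :=
    { toFun := fun w => LinearMap.coprod (π.restrictScalars k) s (w : N × M)
      map_add' := map_add (LinearMap.coprod (π.restrictScalars k) s)
      map_smul' := h₃' }
  refine projective_ker_of_extension π ε i p ψ hπ
    (fun n => show π n + s 0 = π n by rw [map_zero, add_zero])
    (fun w => show ε (π (Prod.fst (α := N) (β := M) w) + s (Prod.snd (α := N) (β := M) w)) =
      Prod.snd (α := N) (β := M) w by rw [map_add, hπ, zero_add, hs])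
    (LinearMap.inl_injective (R := k))
    (fun w hw => ⟨Prod.fst (α := N) (β := M) w, Prod.ext rfl hw.symm⟩) fun f => ?_
  obtain ⟨n, hn⟩ := hπε (f - s (ε f)) (by rw [map_sub, hs, sub_self])
  refine ⟨((n, ε f) : N × M), ?_⟩
  change π n + s (ε f) = f
  rw [hn, sub_add_cancel]

end Sections

/-! ### Submodules of projective k[X]-modules -/

section PolynomialModules

variable {k : Type u} [Field k]

/-- The polynomial ring over a field is hereditary. -/
lemma projective_submodule {F : Type*} [AddCommGroup F] [Module k F] [Module k[X] F]
    [IsScalarTower k k[X] F] [Module.Projective k[X] F] (K : Submodule k[X] F) :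
    Module.Projective k[X] K := by
  let ε : F →ₗ[k[X]] F ⧸ K := K.mkQ
  let π : (K →₀ k[X]) →ₗ[k[X]] F := K.subtype ∘ₗ Finsupp.linearCombination k[X] id
  have hπ (n : K →₀ k[X]) : ε (π n) = 0 := by simp [ε, π]
  have hπε (f : F) (hf : ε f = 0) : ∃ n, π n = f :=
    ⟨Finsupp.single ⟨f, (Submodule.Quotient.mk_eq_zero K).1 hf⟩ (1 : k[X]), by simp [π]⟩
  obtain ⟨s, t, hs, ht⟩ := exists_linear_sections (S := k) (π.restrictScalars k)
    (ε.restrictScalars k) K.mkQ_surjective hπ hπε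
  replace hs (m : F ⧸ K) : ε (s m) = m := hs m
  replace ht (f : F) : ε f = 0 → π (t f) = f := ht f
  let e : (F ⧸ K) →ₗ[k] (K →₀ k[X]) :=
    t ∘ₗ (Algebra.lsmul k k F (X : k[X]) ∘ₗ s - s ∘ₗ Algebra.lsmul k k (F ⧸ K) (X : k[X]))
  have he (m : F ⧸ K) : π (e m) = (X : k[X]) • s m - s ((X : k[X]) • m) :=
    ht _ (by simp [hs])
  -- k[X] is free on X, so any endomorphism defines an action: the extension lifts with no
  -- obstruction.
  let E : Module.End k ((K →₀ k[X]) × (F ⧸ K)) :=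
    Algebra.lsmul k k ((K →₀ k[X]) × (F ⧸ K)) (X : k[X]) +
      LinearMap.inl k _ _ ∘ₗ e ∘ₗ LinearMap.snd k _ _
  have hE (w : (K →₀ k[X]) × (F ⧸ K)) :
      aeval E (X : k[X]) w = ((X : k[X]) • w.1 + e w.2, (X : k[X]) • w.2) := by
    rw [aeval_X]
    ext <;> simp [E]
  have := projective_ker_of_rep π ε s (aeval E) hπ hs hπε adjoin_X
    (by rintro _ rfl n; rw [hE]; simp) (by rintro _ rfl w; rw [hE]) (by
      rintro _ rfl w
      rw [hE, map_add, he, map_smul, smul_add]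
      abel)
  rwa [K.ker_mkQ] at this

end PolynomialModules

/-! ### Sufficiency: connections and vanishing of the obstruction -/

namespace BavulaAlgebra

variable {k : Type u} [Field k] (σ : k[X] ≃ₐ[k] k[X]) (a : k[X])

/-- By the chain rule the factor is (σX)'; the same rule applied to σ⁻¹X shows that it is a unit,
hence a constant. -/
lemma exists_derivative_apply :
    ∃ q : k, q ≠ 0 ∧ ∀ r, derivative (σ r) = C q * σ (derivative r) := by
  have key (r : k[X]) : derivative (σ r) = σ (derivative r) * derivative (σ X) := by
    have h (r : k[X]) : σ r = r.comp (σ X) := by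
      have := aeval_algHom_apply σ.toAlgHom X r
      rw [aeval_X_left_apply] at this
      exact this.symm
    rw [h r, h (derivative r), derivative_comp, mul_comm]
  have hu : IsUnit (derivative (σ X)) := by
    refine IsUnit.of_mul_eq_one (σ (derivative (σ.symm X))) ?_
    rw [mul_comm, ← key, σ.apply_symm_apply, derivative_X]
  obtain ⟨q, hq, hq'⟩ := Polynomial.isUnit_iff.1 hu
  exact ⟨q, hq.ne_zero, fun r => by rw [key, ← hq', mul_comm]⟩

/-- M is a summand of a free module: differentiate the coordinates there and project back. -/
lemma exists_connection (M : Type*) [AddCommGroup M] [Module k M] [Module k[X] M]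
    [IsScalarTower k k[X] M] [Module.Projective k[X] M] :
    ∃ D : M →ₗ[k] M, ∀ (r : k[X]) m, D (r • m) = derivative r • m + r • D m := by
  obtain ⟨i, hi⟩ := (Module.projective_def' (R := k[X]) (P := M)).1 inferInstance
  refine ⟨(Finsupp.linearCombination k[X] id).restrictScalars k ∘ₗ
    Finsupp.mapRange.linearMap derivative ∘ₗ i.restrictScalars k, fun r m => ?_⟩
  have h (w : M →₀ k[X]) : Finsupp.mapRange.linearMap (derivative (R := k)) (r • w) =
      derivative r • w + r • Finsupp.mapRange.linearMap (derivative (R := k)) w := by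
    ext n : 1
    simp [derivative_mul]
  have hm : Finsupp.linearCombination k[X] id (i m) = m := LinearMap.congr_fun hi m
  change Finsupp.linearCombination k[X] id (Finsupp.mapRange.linearMap derivative (i (r • m))) = _
  rw [map_smul, h, map_add, map_smul, map_smul, hm]
  rfl

/-- The restriction of scalars along the structure map. -/
noncomputable instance : Module k[X] (BavulaAlgebra k σ a) :=
  Module.compHom _ (coeff σ a).toRingHom

lemma smul_def (r : k[X]) (z : BavulaAlgebra k σ a) : r • z = coeff σ a r * z := rfl

instance : IsScalarTower k[X] (BavulaAlgebra k σ a) (BavulaAlgebra k σ a) where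
  smul_assoc r z w := by simp only [smul_def, smul_eq_mul, mul_assoc]

instance : IsScalarTower k k[X] (BavulaAlgebra k σ a) where
  smul_assoc c r z := by rw [smul_def, smul_def, map_smul, smul_mul_assoc]

instance : Module.Free k[X] (BavulaAlgebra k σ a) := by
  let ρ : BavulaAlgebra k σ a →ₗ[k[X]] (ℤ →₀ k[X]) :=
    { toFun := coords σ a
      map_add' := map_add _
      map_smul' := coords_coeff_mul σ a }
  refine Module.Free.of_equiv (LinearEquiv.ofBijective ρ ⟨coords_injective σ a, fun w => ?_⟩).symm
  induction w using Finsupp.induction_linear with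
  | zero => exact ⟨0, map_zero ρ⟩
  | add v w hv hw =>
    obtain ⟨z, rfl⟩ := hv
    obtain ⟨z', rfl⟩ := hw
    exact ⟨z + z', map_add ρ z z'⟩
  | single n r => exact ⟨coeff σ a r * monomial σ a n, coords_coeff_mul_monomial σ a r n⟩

section Modules

variable {σ a}
variable {M : Type*} [AddCommGroup M] [Module (BavulaAlgebra k σ a) M] [Module k[X] M]
  [IsScalarTower k[X] (BavulaAlgebra k σ a) M]

lemma coeff_smul (r : k[X]) (m : M) : coeff σ a r • m = r • m := by
  rw [← mul_one (coeff σ a r), ← smul_def, smul_assoc, one_smul]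

lemma y_smul_x_smul (m : M) : y σ a • x σ a • m = a • m := by
  rw [smul_smul, y_mul_x, coeff_smul]

lemma x_smul_y_smul (m : M) : x σ a • y σ a • m = σ a • m := by
  rw [smul_smul, x_mul_y, coeff_smul]

lemma x_smul_smul (r : k[X]) (m : M) : x σ a • r • m = σ r • x σ a • m := by
  rw [← coeff_smul (σ := σ) (a := a), smul_smul, x_mul_coeff, mul_smul, coeff_smul]

lemma y_smul_smul (r : k[X]) (m : M) : y σ a • σ r • m = r • y σ a • m := by
  rw [← coeff_smul (σ := σ) (a := a), smul_smul, ← coeff_mul_y, mul_smul, coeff_smul]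

variable {N : Type*} [AddCommGroup N] [Module (BavulaAlgebra k σ a) N] [Module k[X] N]
  [Module k M] [IsScalarTower k k[X] M] [IsScalarTower k (BavulaAlgebra k σ a) M] [Module k N]

/-- The commutators of a connection with the generators are semilinear, and they express the
derivative of `a` as a homotopy. -/
lemma exists_homotopy_derivative [Module.Projective k[X] M] :
    ∃ e f : M →ₗ[k] M, (∀ (r : k[X]) m, e (r • m) = σ r • e m) ∧
      (∀ (r : k[X]) m, f (σ r • m) = r • f m) ∧
      (∀ m, y σ a • e m + f (x σ a • m) = derivative a • m) ∧
      ∀ m, x σ a • f m + e (y σ a • m) = σ (derivative a) • m := by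
  obtain ⟨q, hq, hσ⟩ := exists_derivative_apply σ
  obtain ⟨D, hD⟩ := exists_connection (k := k) M
  have hC (c : k) (m : M) : c • m = (C c : k[X]) • m := by
    rw [← mul_one (C c), ← smul_eq_C_mul, smul_assoc, one_smul]
  have hσC (c : k) : σ (C c) = C c := σ.commutes c
  have hqq : C q⁻¹ * C q = (1 : k[X]) := by rw [← C_mul, inv_mul_cancel₀ hq, C_1]
  have hDσ (r : k[X]) (m : M) : D (σ r • m) = (C q * σ (derivative r)) • m + σ r • D m := by
    rw [hD, hσ]
  -- The factor q⁻¹ compensates (σr)' = qσ(r'), so the derivative terms cancel and the twisted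
  -- commutators are semilinear. In ye + fx the mixed terms cancel too, leaving [D, a] = a'.
  refine ⟨q⁻¹ • D ∘ₗ Algebra.lsmul k k M (x σ a) - Algebra.lsmul k k M (x σ a) ∘ₗ D,
    D ∘ₗ Algebra.lsmul k k M (y σ a) - q⁻¹ • Algebra.lsmul k k M (y σ a) ∘ₗ D, ?_, ?_, ?_, ?_⟩
  · intro r m
    change q⁻¹ • D (x σ a • r • m) - x σ a • D (r • m) = σ r • (q⁻¹ • D (x σ a • m) - x σ a • D m)
    rw [x_smul_smul, hDσ, hD, smul_add (x σ a), x_smul_smul, x_smul_smul, hC, hC]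
    generalize x σ a • D m = v
    generalize D (x σ a • m) = w
    generalize x σ a • m = m'
    linear_combination (norm := module) hqq • (σ (derivative r) • m')
  · intro r m
    change D (y σ a • σ r • m) - q⁻¹ • y σ a • D (σ r • m) =
      r • (D (y σ a • m) - q⁻¹ • y σ a • D m)
    rw [y_smul_smul, hDσ, hD, smul_add (y σ a), y_smul_smul, ← hσC q, ← map_mul, y_smul_smul, hC,
      hC]
    generalize y σ a • D m = v
    generalize D (y σ a • m) = w
    generalize y σ a • m = m'
    linear_combination (norm := module) -hqq • (derivative r • m')
  · intro m
    change y σ a • (q⁻¹ • D (x σ a • m) - x σ a • D m) +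
      (D (y σ a • x σ a • m) - q⁻¹ • y σ a • D (x σ a • m)) = _
    rw [smul_sub, y_smul_x_smul, y_smul_x_smul, hD, smul_comm (y σ a)]
    abel
  · intro m
    change x σ a • (D (y σ a • m) - q⁻¹ • y σ a • D m) +
      (q⁻¹ • D (x σ a • y σ a • m) - x σ a • D (y σ a • m)) = _
    rw [smul_sub, x_smul_y_smul, hDσ, smul_comm (x σ a), x_smul_y_smul, hC, hC]
    generalize x σ a • D (y σ a • m) = v
    linear_combination (norm := module) hqq • (σ (derivative a) • m)

/-- If `a` is separable, then the cocycles `(g, h)` of degree two are coboundaries. -/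
lemma exists_homotopy [Module.Projective k[X] M] (ha : IsCoprime a (derivative a))
    (P : Submodule (BavulaAlgebra k σ a) N) (g h : M →ₗ[k] N)
    (hg : ∀ (r : k[X]) m, g (r • m) = r • g m) (hh : ∀ (r : k[X]) m, h (r • m) = r • h m)
    (hx : ∀ m, x σ a • g m = h (x σ a • m)) (hy : ∀ m, y σ a • h m = g (y σ a • m))
    (hgP : ∀ m, g m ∈ P) (hhP : ∀ m, h m ∈ P) :
    ∃ e f : M →ₗ[k] N, (∀ (r : k[X]) m, e (r • m) = σ r • e m) ∧
      (∀ (r : k[X]) m, f (σ r • m) = r • f m) ∧ (∀ m, e m ∈ P) ∧ (∀ m, f m ∈ P) ∧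
      (∀ m, y σ a • e m + f (x σ a • m) = g m) ∧
      ∀ m, x σ a • f m + e (y σ a • m) = h m := by
  obtain ⟨α, β, hαβ⟩ := ha
  obtain ⟨e, f, he, hf, hef, hfe⟩ := exists_homotopy_derivative (σ := σ) (a := a) (k := k) (M := M)
  let L (z : k[X]) := Algebra.lsmul k k M z
  -- The pair (x, 0) is a homotopy for a and (e, f) one for a'. Their Bézout combination is a
  -- homotopy for 1, and composing it with (g, h) gives the result.
  refine ⟨h ∘ₗ (e ∘ₗ L β + Algebra.lsmul k k M (x σ a) ∘ₗ L α), g ∘ₗ f ∘ₗ L (σ β), ?_, ?_,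
    fun m => hhP _, fun m => hgP _, ?_, ?_⟩
  · intro r m
    change h (e (β • r • m) + x σ a • α • r • m) = σ r • h (e (β • m) + x σ a • α • m)
    rw [smul_comm β, smul_comm α, he, x_smul_smul r, ← smul_add, hh]
  · intro r m
    change g (f (σ β • σ r • m)) = r • g (f (σ β • m))
    rw [smul_comm, hf, hg]
  · intro m
    change y σ a • h (e (β • m) + x σ a • α • m) + g (f (σ β • x σ a • m)) = g m
    rw [hy, ← map_add, ← x_smul_smul, smul_add, y_smul_x_smul, add_right_comm, hef, smul_smul,
      smul_smul, ← add_smul, show derivative a * β + a * α = 1 by rw [← hαβ]; ring, one_smul]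
  · intro m
    change x σ a • g (f (σ β • m)) + h (e (β • y σ a • m) + x σ a • α • y σ a • m) = h m
    rw [hx, ← map_add, ← y_smul_smul, ← y_smul_smul, x_smul_y_smul, ← add_assoc, hfe, smul_smul,
      smul_smul, ← add_smul, ← map_mul, ← map_mul, ← map_add,
      show derivative a * β + a * α = 1 by rw [← hαβ]; ring, map_one, one_smul]

variable {F : Type*} [AddCommGroup F] [Module (BavulaAlgebra k σ a) F] [Module k[X] F]
  [IsScalarTower k[X] (BavulaAlgebra k σ a) F] [Module k F] [IsScalarTower k k[X] F]
  [IsScalarTower k (BavulaAlgebra k σ a) F] [IsScalarTower k[X] (BavulaAlgebra k σ a) N]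
  [IsScalarTower k k[X] N] [IsScalarTower k (BavulaAlgebra k σ a) N]

/-- If `a` is separable, then modules that are projective over `k[X]` have projective dimension at
most one. -/
lemma projective_ker [Module.Projective k[X] M] (ha : IsCoprime a (derivative a))
    [Module.Projective (BavulaAlgebra k σ a) F] [Module.Projective (BavulaAlgebra k σ a) N]
    (π : N →ₗ[BavulaAlgebra k σ a] F) (ε : F →ₗ[BavulaAlgebra k σ a] M)
    [Module.Projective k[X] (LinearMap.ker (ε.restrictScalars k[X]))]
    (hε : Function.Surjective ε) (hπ : ∀ n, ε (π n) = 0) (hπε : ∀ f, ε f = 0 → ∃ n, π n = f) :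
    Module.Projective (BavulaAlgebra k σ a) (LinearMap.ker ε) := by
  obtain ⟨s, t, hs, ht⟩ := exists_linear_sections (S := k[X]) (π.restrictScalars k[X])
    (ε.restrictScalars k[X]) hε hπ hπε
  replace hs (m : M) : ε (s m) = m := hs m
  replace ht (f : F) : ε f = 0 → π (t f) = f := ht f
  let sk := s.restrictScalars k
  -- A lift to N of the failure of s to commute with z.
  let d (z : BavulaAlgebra k σ a) : M →ₗ[k] N := t.restrictScalars k ∘ₗ
    (Algebra.lsmul k k F z ∘ₗ sk - sk ∘ₗ Algebra.lsmul k k M z)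
  have hd (z) (m : M) : d z m = t (z • s m - s (z • m)) := rfl
  have hπd (z) (m : M) : π (d z m) = z • s m - s (z • m) :=
    ht (z • s m - s (z • m)) (by rw [map_sub, map_smul, hs, hs, sub_self])
  have he (r : k[X]) (m : M) : d (x σ a) (r • m) = σ r • d (x σ a) m := by
    rw [hd, hd, map_smul s, x_smul_smul, x_smul_smul, map_smul, ← smul_sub, map_smul]
  have hf (r : k[X]) (m : M) : d (y σ a) (σ r • m) = r • d (y σ a) m := by
    rw [hd, hd, map_smul s, y_smul_smul, y_smul_smul, map_smul, ← smul_sub, map_smul]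
  -- If x and y act on N × M with corrections d(x) and d(y), then g and h are the errors in yx = a
  -- and xy = σ(a). They take values in ker π because F satisfies these relations.
  let g : M →ₗ[k] N := Algebra.lsmul k k N (y σ a) ∘ₗ d (x σ a) +
    d (y σ a) ∘ₗ Algebra.lsmul k k M (x σ a)
  let h : M →ₗ[k] N := Algebra.lsmul k k N (x σ a) ∘ₗ d (y σ a) +
    d (x σ a) ∘ₗ Algebra.lsmul k k M (y σ a)
  have hg (m : M) : g m = y σ a • d (x σ a) m + d (y σ a) (x σ a • m) := rfl
  have hh (m : M) : h m = x σ a • d (y σ a) m + d (x σ a) (y σ a • m) := rfl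
  obtain ⟨e, f, he', hf', heP, hfP, hef, hfe⟩ := exists_homotopy ha (LinearMap.ker π) g h
    (fun r m => by rw [hg, hg, he, y_smul_smul, x_smul_smul, hf, smul_add])
    (fun r m => by
      obtain ⟨r, rfl⟩ := σ.surjective r
      rw [hh, hh, hf, x_smul_smul, y_smul_smul, he, smul_add])
    (fun m => by
      rw [hg, hh, smul_add, x_smul_y_smul, y_smul_x_smul, he, add_comm])
    (fun m => by
      rw [hg, hh, smul_add, y_smul_x_smul, x_smul_y_smul, hf, add_comm])
    (fun m => by
      rw [LinearMap.mem_ker, hg, map_add, map_smul, hπd, hπd, smul_sub, y_smul_x_smul,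
        y_smul_x_smul, map_smul s]
      abel)
    (fun m => by
      rw [LinearMap.mem_ker, hh, map_add, map_smul, hπd, hπd, smul_sub, x_smul_y_smul,
        x_smul_y_smul, map_smul s]
      abel)
  -- Since e and f land in ker π, the corrected maps still lift the failure of s, and now the
  -- relations hold exactly.
  let E := d (x σ a) - e
  let E' := d (y σ a) - f
  have hE (r : k[X]) (m : M) : E (r • m) = σ r • E m := by
    simp only [E, LinearMap.sub_apply, he, he', smul_sub]
  have hE' (r : k[X]) (m : M) : E' (σ r • m) = r • E' m := by
    simp only [E', LinearMap.sub_apply, hf, hf', smul_sub]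
  have hπE (m : M) : π (E m) = x σ a • s m - s (x σ a • m) := by
    have : π (e m) = 0 := heP m
    rw [← hπd, LinearMap.sub_apply, map_sub, this, sub_zero]
  have hπE' (m : M) : π (E' m) = y σ a • s m - s (y σ a • m) := by
    have : π (f m) = 0 := hfP m
    rw [← hπd, LinearMap.sub_apply, map_sub, this, sub_zero]
  have hYX (m : M) : y σ a • E m + E' (x σ a • m) = 0 := by
    simp only [E, E', LinearMap.sub_apply, smul_sub]
    rw [sub_add_sub_comm, hef, hg, sub_self]
  have hXY (m : M) : x σ a • E' m + E (y σ a • m) = 0 := by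
    simp only [E, E', LinearMap.sub_apply, smul_sub]
    rw [sub_add_sub_comm, hfe, hh, sub_self]
  let ρ : k[X] →ₐ[k] Module.End k (N × M) := Algebra.lsmul k k (N × M)
  let ξ : Module.End k (N × M) := Algebra.lsmul k k (N × M) (x σ a) +
    LinearMap.inl k N M ∘ₗ E ∘ₗ LinearMap.snd k N M
  let η : Module.End k (N × M) := Algebra.lsmul k k (N × M) (y σ a) +
    LinearMap.inl k N M ∘ₗ E' ∘ₗ LinearMap.snd k N M
  have hρ (r w) : ρ r w = (r • w.1, r • w.2) := rfl
  have hξ (w) : ξ w = (x σ a • w.1 + E w.2, x σ a • w.2) := by ext <;> simp [ξ]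
  have hη (w) : η w = (y σ a • w.1 + E' w.2, y σ a • w.2) := by ext <;> simp [η]
  let φ : BavulaAlgebra k σ a →ₐ[k] Module.End k (N × M) := lift σ a ρ ξ η
    (LinearMap.ext fun w => by
      rw [Module.End.mul_apply, hξ, hη, hρ]
      simp only [smul_add, add_assoc, hYX, add_zero, y_smul_x_smul])
    (LinearMap.ext fun w => by
      rw [Module.End.mul_apply, hξ, hη, hρ]
      simp only [smul_add, add_assoc, hXY, add_zero, x_smul_y_smul])
    (fun r => LinearMap.ext fun w => by
      rw [Module.End.mul_apply, Module.End.mul_apply, hξ, hξ, hρ, hρ]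
      simp only [smul_add, hE, x_smul_smul])
    (fun r => LinearMap.ext fun w => by
      rw [Module.End.mul_apply, Module.End.mul_apply, hη, hη, hρ, hρ]
      simp only [smul_add, hE', y_smul_smul])
  have hφr (r) : φ (coeff σ a r) = ρ r := lift_coeff ..
  have hφx : φ (x σ a) = ξ := lift_x ..
  have hφy : φ (y σ a) = η := lift_y ..
  refine projective_ker_of_rep π ε sk φ hπ hs hπε (adjoin_generators σ a) ?_ ?_ ?_
  · rintro _ (⟨r, rfl⟩ | rfl | rfl) n
    · rw [hφr, hρ, coeff_smul, smul_zero]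
    · rw [hφx, hξ, map_zero, smul_zero, add_zero]
    · rw [hφy, hη, map_zero, smul_zero, add_zero]
  · rintro _ (⟨r, rfl⟩ | rfl | rfl) w
    · rw [hφr, hρ, coeff_smul]
    · rw [hφx, hξ]
    · rw [hφy, hη]
  · rintro _ (⟨r, rfl⟩ | rfl | rfl) w
    · rw [hφr, hρ, coeff_smul, smul_add, ← coeff_smul (σ := σ) (a := a) r w.1, map_smul, coeff_smul]
      exact congrArg _ (map_smul s r w.2)
    · rw [hφx, hξ, map_add, map_smul, hπE, smul_add, add_assoc]
      exact congrArg _ (sub_add_cancel _ _)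
    · rw [hφy, hη, map_add, map_smul, hπE', smul_add, add_assoc]
      exact congrArg _ (sub_add_cancel _ _)

end Modules

/-- Submodules of modules that are projective over `k[X]` are projective over `k[X]`. -/
lemma projective_restrictScalars {F : Type*} [AddCommGroup F] [Module (BavulaAlgebra k σ a) F]
    [Module k[X] F] [IsScalarTower k[X] (BavulaAlgebra k σ a) F] [Module k F]
    [IsScalarTower k k[X] F] [Module.Projective k[X] F] (S : Submodule (BavulaAlgebra k σ a) F) :
    Module.Projective k[X] (S.restrictScalars k[X]) :=
  projective_submodule (S.restrictScalars k[X])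

/-! ### Free covers and the bound two -/

section FreeCover

/-- The free module on the elements of a module. -/
def FreeCover (V : Type*) : Type _ := V →₀ BavulaAlgebra k σ a

variable (V : Type*)

noncomputable instance : AddCommGroup (FreeCover σ a V) :=
  inferInstanceAs (AddCommGroup (V →₀ BavulaAlgebra k σ a))

noncomputable instance : Module (BavulaAlgebra k σ a) (FreeCover σ a V) :=
  inferInstanceAs (Module (BavulaAlgebra k σ a) (V →₀ BavulaAlgebra k σ a))

noncomputable instance : Module k[X] (FreeCover σ a V) :=
  inferInstanceAs (Module k[X] (V →₀ BavulaAlgebra k σ a))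

noncomputable instance : Module k (FreeCover σ a V) :=
  inferInstanceAs (Module k (V →₀ BavulaAlgebra k σ a))

instance : IsScalarTower k[X] (BavulaAlgebra k σ a) (FreeCover σ a V) :=
  inferInstanceAs (IsScalarTower k[X] (BavulaAlgebra k σ a) (V →₀ BavulaAlgebra k σ a))

instance : IsScalarTower k (BavulaAlgebra k σ a) (FreeCover σ a V) :=
  inferInstanceAs (IsScalarTower k (BavulaAlgebra k σ a) (V →₀ BavulaAlgebra k σ a))

instance : IsScalarTower k k[X] (FreeCover σ a V) :=
  inferInstanceAs (IsScalarTower k k[X] (V →₀ BavulaAlgebra k σ a))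

instance : Module.Projective (BavulaAlgebra k σ a) (FreeCover σ a V) :=
  inferInstanceAs (Module.Projective (BavulaAlgebra k σ a) (V →₀ BavulaAlgebra k σ a))

instance : Module.Free k[X] (FreeCover σ a V) :=
  inferInstanceAs (Module.Free k[X] (V →₀ BavulaAlgebra k σ a))

lemma exists_freeCover_surjective [AddCommGroup V] [Module (BavulaAlgebra k σ a) V] :
    ∃ ε : FreeCover σ a V →ₗ[BavulaAlgebra k σ a] V, Function.Surjective ε :=
  ⟨(Finsupp.linearCombination (BavulaAlgebra k σ a) id : (V →₀ BavulaAlgebra k σ a) →ₗ[_] V),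
    Finsupp.linearCombination_id_surjective _ _⟩

end FreeCover

open CategoryTheory in
/-- If `a` is separable, then modules that are projective over `k[X]` have projective dimension at
most one. -/
lemma hasProjectiveDimensionLT_two (ha : IsCoprime a (derivative a)) (V : Type u) [AddCommGroup V]
    [Module (BavulaAlgebra k σ a) V] [Module k[X] V] [IsScalarTower k[X] (BavulaAlgebra k σ a) V]
    [Module k V] [IsScalarTower k k[X] V] [IsScalarTower k (BavulaAlgebra k σ a) V]
    [Module.Projective k[X] V] :
    HasProjectiveDimensionLT (ModuleCat.of (BavulaAlgebra k σ a) V) 2 := by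
  obtain ⟨ε, hε⟩ := exists_freeCover_surjective σ a V
  obtain ⟨π, hπ⟩ := exists_freeCover_surjective σ a (LinearMap.ker ε)
  have : Module.Projective k[X] (LinearMap.ker (ε.restrictScalars k[X])) :=
    projective_restrictScalars σ a (LinearMap.ker ε)
  have h₀ (n) : ε (((LinearMap.ker ε).subtype ∘ₗ π) n) = 0 := LinearMap.mem_ker.1 (π n).2
  have h₀' (f) (hf : ε f = 0) : ∃ n, ((LinearMap.ker ε).subtype ∘ₗ π) n = f :=
    (hπ ⟨f, hf⟩).imp fun n hn => congrArg Subtype.val hn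
  have hP : Module.Projective (BavulaAlgebra k σ a) (LinearMap.ker ε) :=
    projective_ker ha ((LinearMap.ker ε).subtype ∘ₗ π) ε hε h₀ h₀'
  exact hasProjectiveDimensionLT_of_surjective ε hε 0
    (projective_iff_hasProjectiveDimensionLT_one.1 ((IsProjective.iff_projective _).1 hP))

open CategoryTheory in
theorem leftGlobalDimension_lt_top_of_isCoprime (ha : IsCoprime a (derivative a)) :
    leftGlobalDimension (BavulaAlgebra k σ a) < ⊤ := by
  refine leftGlobalDimension_lt_top_iff.2 ⟨2, fun M => ?_⟩
  obtain ⟨ε, hε⟩ := exists_freeCover_surjective σ a M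
  -- The cover is also free over k[X], so its submodule is projective there and has projective
  -- dimension at most 1 over Λ; M gains one more.
  have : Module.Projective k[X] (LinearMap.ker ε) :=
    projective_restrictScalars σ a (LinearMap.ker ε)
  exact hasProjectiveDimensionLT_of_surjective ε hε 1
    (hasProjectiveDimensionLT_two σ a ha (LinearMap.ker ε))

end BavulaAlgebra

theorem mainTheorem3 {k : Type u} [Field k] [CharZero k] (σ : k[X] ≃ₐ[k] k[X]) (a : k[X]) :
    leftGlobalDimension (BavulaAlgebra k σ a) < ⊤ ↔ IsCoprime a (derivative a) :=
  ⟨BavulaAlgebra.isCoprime_of_leftGlobalDimension_lt_top σ a,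
    BavulaAlgebra.leftGlobalDimension_lt_top_of_isCoprime σ a⟩
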